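/- **Setting.** Let $\sigma:\mathbb R\to\mathbb R$ be absolutely continuous on bounded intervals, with $\sigma,\dot\sigma$ square integrable with respect to $\mathcal N(0,1)$, and normalized: $\mathbb E[\sigma(X)]=0$, $\mathbb V[\sigma(X)]=1$ for $X\sim\mathcal N(0,1)$. Let $\mu:=1-(\mathbb E[X\sigma(X)])^2$ be its coefficient of nonlinearity and assume $\mu>0$ (i.e. $\sigma$ is not linear). For $\varphi\in\{\sigma,\dot\sigma\}$ and $\rho\in[-1,1]$ let $\hat\varphi(\rho):=\mathbb E[\varphi(u)\varphi(v)]$, where $(u,v)$ is centred Gaussian with unit variances and correlation $\rho$, and let $\hat\sigma^{(\ell)}$ be the $\ell$-fold composition of $\hat\sigma$. The neural tangent kernel of the fully-connected network with $L$ hidden layers is, for unit vectors $p,q\in\mathbb R^d$ with $\rho=p\cdot q$, $$k(p,q)=\hat k(\rho)=\sum_{h=1}^{L+1}\hat\sigma^{(h-1)}(\rho)\prod_{h'=h}^{L}\hat{\dot\sigma}\big(\hat\sigma^{(h'-\tau)}(\rho)\big),$$ where $\tau\in\{0,1\}$ is the indexing convention for the derivative factors (the result holds for both: $\tau=0$ evaluates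 the factor of layer $h'$ at the correlation after that layer, $\tau=1$ at the correlation before it). Let $(\mathbf x_i,y_i)_{i=1}^n$, $n\ge1$, be training data with $\mathbf x_i\in\mathbb R^d$, $|\mathbf x_i|=1$, $y_i\in\{-1,1\}$, and let $0<\delta\le1$ satisfy $|\mathbf x_i\cdot\mathbf x_j|\le1-\delta$ for all $i\ne j$. Put $K_{ij}=k(\mathbf x_i,\mathbf x_j)$, $L_{\mathrm{conv}}=8\log(n/\delta)/\mu$ and $M=K_{11}I$; let $\|\cdot\|$ be the spectral norm. For a unit test vector $\mathbf x_*\in\mathbb R^d$ put $\mathbf k_*=(k(\mathbf x_*,\mathbf x_i))_i$. The infinite-width network $f_t$ ($t\ge 0$ is the training time) is the random function on the unit sphere whose initialization $f_0$ is a centred Gaussian process with covariance $\hat\sigma^{(L)}(p\cdot q)$, and which is trained by gradient descent (gradient flow) on the loss $\frac12\sum_i(f(\mathbf x_i)-y_i)^2$, that is, for each $p$, almost surely for all $t\ge0$, $\partial_t f_t(p)=-\sum_i k(p,\mathbf x_i)\,(f_t(\mathbf x_i)-y_i)$. **Theorem.** There is a universal constant $C$ (independent of $\sigma,\mu,\tau,d,n,\delta,L$,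 the data and the test point) such that, whenever $L\ge L_{\mathrm{conv}}$: 1. $K$ and $M$ are invertible, and $$\frac{\|M^{-1}-K^{-1}\|}{\|K^{-1}\|}\le\frac Cn .$$ 2. For every unit test vector $\mathbf x_*$, the output $f_t(\mathbf x_*)$ converges almost surely as $t\to\infty$ to an integrable random variable $f_*$ with $\mathbb E[f_*]=\mathbf k_*^{T}K^{-1}\mathbf y$, and $$\Big|\mathbb E[f_*]-\tfrac1{K_{11}}\,\mathbf k_*^{T}\mathbf y\Big|\le\frac Cn ,$$ i.e. $\mathbb E[f_*]$ is approximated up to $O(1/n)$ by $\mathbf k_*^T\mathbf y$ when the kernel is normalized to have unit diagonal. -/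

import Mathlib

open MeasureTheory ProbabilityTheory Filter Topology
open scoped Matrix Matrix.Norms.L2Operator

noncomputable section

/-- The unit sphere of `ℝ^d`. -/
abbrev UnitSphere (d : ℕ) : Type := Metric.sphere (0 : EuclideanSpace ℝ (Fin d)) 1

/-- The inner product `p · q` of two points of the unit sphere. -/
def sphereInner {d : ℕ} (p q : UnitSphere d) : ℝ :=
  inner ℝ (p : EuclideanSpace ℝ (Fin d)) (q : EuclideanSpace ℝ (Fin d))

/-- The activation is normalized: `E[σ(X)] = 0` and `V[σ(X)] = 1` for `X ∼ N(0,1)`. It has a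
derivative in the almost-everywhere sense (it is absolutely continuous on every bounded interval),
and activation and derivative are square integrable for the Gaussian measure, so that the dual
activations of both are finite. -/
structure IsNormalizedActivation (σ : ℝ → ℝ) : Prop where
  absolutelyContinuous : ∀ a b : ℝ, AbsolutelyContinuousOnInterval σ a b
  memLp : MemLp σ 2 (gaussianReal 0 1)
  memLp_deriv : MemLp (deriv σ) 2 (gaussianReal 0 1)
  mean_eq_zero : ∫ z, σ z ∂(gaussianReal 0 1) = 0
  variance_eq_one : variance σ (gaussianReal 0 1) = 1

/-- The coefficient of nonlinearity `μ = 1 - (E[X σ(X)])²`, `X ∼ N(0,1)`. -/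
def nonlinearityCoeff (σ : ℝ → ℝ) : ℝ :=
  1 - (∫ z, z * σ z ∂(gaussianReal 0 1)) ^ 2

/-- The dual activation `φ̂(ρ) = E[φ(w · p) φ(w · q)]`, with `w` standard Gaussian and `p, q` unit
vectors such that `p · q = ρ`. By rotation invariance only the plane spanned by `p, q` matters, and
there we take `p = (1, 0)` and `q = (ρ, √(1 - ρ²))`. -/
def dualActivation (φ : ℝ → ℝ) (ρ : ℝ) : ℝ :=
  ∫ w : ℝ × ℝ, φ w.1 * φ (ρ * w.1 + √(1 - ρ ^ 2) * w.2)
    ∂((gaussianReal 0 1).prod (gaussianReal 0 1))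

/-- The neural tangent kernel of the fully-connected network with `L` hidden layers, as a function
of the inner product of the two inputs:
`k̂(ρ) = ∑_{h=1}^{L+1} σ̂^{(h-1)}(ρ) ∏_{h'=h}^{L} (σ̇)^(σ̂^{(h'-τ)}(ρ))`,
where `σ̂^{(ℓ)}` is the `ℓ`-fold composition of the dual activation of `σ`, and `(σ̇)^` is the dual
activation of the derivative. The number `τ ∈ {0, 1}` is the indexing convention for the derivative
factors: `τ = 0` evaluates the factor of layer `h'` at the correlation `σ̂^{(h')}(ρ)` after that
layer, and `τ = 1` at the correlation `σ̂^{(h'-1)}(ρ)` before it. -/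
def ntk (σ : ℝ → ℝ) (τ : Fin 2) (L : ℕ) (ρ : ℝ) : ℝ :=
  ∑ h ∈ Finset.Icc 1 (L + 1), (dualActivation σ)^[h - 1] ρ *
    ∏ h' ∈ Finset.Icc h L, dualActivation (deriv σ) ((dualActivation σ)^[h' - (τ : ℕ)] ρ)

/-- The matrix `K` of the kernel on the training set. -/
def ntkMatrix (σ : ℝ → ℝ) (τ : Fin 2) (L : ℕ) {d n : ℕ} (x : Fin n → UnitSphere d) :
    Matrix (Fin n) (Fin n) ℝ :=
  Matrix.of fun i j => ntk σ τ L (sphereInner (x i) (x j))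

/-- The vector `k_*` of the kernel between a test point and the training set. -/
def ntkVector (σ : ℝ → ℝ) (τ : Fin 2) (L : ℕ) {d n : ℕ} (x : Fin n → UnitSphere d)
    (p : UnitSphere d) : Fin n → ℝ :=
  fun i => ntk σ τ L (sphereInner p (x i))

/-- The depth `L_conv = 8 log(n/δ) / μ`. -/
def convDepth (n : ℕ) (δ μ : ℝ) : ℝ := 8 * Real.log (n / δ) / μ

/-- `f t p ω` is the output on `p`, at training time `t ≥ 0` and for the random initialization `ω`,
of an infinite-width network with `L` hidden layers trained on `(x, y)` with the squared loss
`½ ∑ᵢ (f(xᵢ) - yᵢ)²`. At initialization the output is a centred Gaussian process with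
covariance `σ̂^{(L)}(p · q)`. In the infinite-width limit gradient descent is
the linear dynamics `∂ₜ f_t(p) = - ∑ᵢ k(p, xᵢ) (f_t(xᵢ) - yᵢ)` driven by the neural tangent kernel. -/
structure IsInfiniteWidthTraining (σ : ℝ → ℝ) (τ : Fin 2) (L : ℕ) {d n : ℕ}
    (x : Fin n → UnitSphere d) (y : Fin n → ℝ) {Ω : Type*} [MeasurableSpace Ω] (P : Measure Ω)
    (f : ℝ → UnitSphere d → Ω → ℝ) : Prop where
  gaussian_init : IsGaussianProcess (f 0) P
  mean_init : ∀ p, ∫ ω, f 0 p ω ∂P = 0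
  covariance_init : ∀ p q,
    covariance (f 0 p) (f 0 q) P = (dualActivation σ)^[L] (sphereInner p q)
  gradient_flow : ∀ p, ∀ᵐ ω ∂P, ∀ t, 0 ≤ t →
    HasDerivWithinAt (fun s => f s p ω)
      (-∑ i, ntk σ τ L (sphereInner p (x i)) * (f t (x i) ω - y i)) (Set.Ici 0) t

end

section GaussianIntegrationByParts

open Polynomial

/-- A function on the line that has the integrable derivative `h` in the integrated sense and is
itself integrable satisfies `∫ h = 0`. -/
theorem integral_eq_zero_of_sub_eq_intervalIntegral {F h : ℝ → ℝ} (hF : Integrable F)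
    (hh : Integrable h) (hFh : ∀ a b, F b - F a = ∫ x in a..b, h x) : ∫ x, h x = 0 := by
  have htop : Tendsto F atTop (𝓝 (F 0 + ∫ x in Set.Ioi 0, h x)) := by
    have := (intervalIntegral_tendsto_integral_Ioi 0 hh.integrableOn tendsto_id).const_add (F 0)
    refine this.congr fun b => ?_
    rw [id, ← hFh]; ring
  have hbot : Tendsto F atBot (𝓝 (F 0 - ∫ x in Set.Iic 0, h x)) := by
    have := (intervalIntegral_tendsto_integral_Iic 0 hh.integrableOn tendsto_id).const_sub (F 0)
    refine this.congr fun b => ?_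
    rw [id, ← hFh]; ring
  have h1 := (hF.integrableAtFilter atTop).eq_zero_of_tendsto (fun s hs => by
    obtain ⟨a, ha⟩ := mem_atTop_sets.1 hs
    exact top_le_iff.1 <| (Real.volume_Ici (a := a)).symm.le.trans (measure_mono ha)) htop
  have h2 := (hF.integrableAtFilter atBot).eq_zero_of_tendsto (fun s hs => by
    obtain ⟨a, ha⟩ := mem_atBot_sets.1 hs
    exact top_le_iff.1 <| (Real.volume_Iic (a := a)).symm.le.trans (measure_mono ha)) hbot
  rw [← intervalIntegral.integral_Iic_add_Ioi (b := 0) hh.integrableOn hh.integrableOn]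
  linarith

theorem integrable_gaussianReal_iff {f : ℝ → ℝ} :
    Integrable f (gaussianReal 0 1) ↔ Integrable fun x => gaussianPDFReal 0 1 x * f x := by
  rw [gaussianReal_of_var_ne_zero _ one_ne_zero,
    integrable_withDensity_iff_integrable_smul' (measurable_gaussianPDF _ _)
      (ae_of_all _ fun _ => gaussianPDF_lt_top)]
  simp

theorem integrable_pow_gaussianReal (n : ℕ) :
    Integrable (fun x : ℝ => x ^ n) (gaussianReal 0 1) := by
  refine (memLp_id_gaussianReal (μ := 0) (v := 1) (n : NNReal)).integrable_norm_pow' |>.mono'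
    (by fun_prop) (ae_of_all _ fun x => by simp)

theorem integrable_eval_gaussianReal (p : ℝ[X]) :
    Integrable (fun x => p.eval x) (gaussianReal 0 1) := by
  simp_rw [Polynomial.eval_eq_sum_range]
  exact integrable_finsetSum _ fun i _ => (integrable_pow_gaussianReal i).const_mul _

theorem memLp_eval_gaussianReal (p : ℝ[X]) :
    MemLp (fun x => p.eval x) 2 (gaussianReal 0 1) := by
  rw [memLp_two_iff_integrable_sq p.continuous.aestronglyMeasurable]
  exact (integrable_eval_gaussianReal (p ^ 2)).congr (ae_of_all _ fun x => eval_pow 2)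

theorem contDiff_eval (p : ℝ[X]) : ContDiff ℝ 1 fun x => p.eval x := by
  simp_rw [Polynomial.eval_eq_sum_range]
  fun_prop

theorem hasDerivAt_gaussianPDFReal (x : ℝ) :
    HasDerivAt (gaussianPDFReal 0 1) (-(x * gaussianPDFReal 0 1 x)) x := by
  have h : HasDerivAt (fun x : ℝ => -(x - 0) ^ 2 / (2 * ((1 : NNReal) : ℝ))) (-x) x := by
    have := (((hasDerivAt_id x).sub_const 0).pow 2).neg.div_const (2 * ((1 : NNReal) : ℝ))
    refine this.congr_deriv ?_
    simp; ring
  have := h.exp.const_mul (√(2 * Real.pi * ((1 : NNReal) : ℝ)))⁻¹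
  rw [gaussianPDFReal_def]
  refine this.congr_deriv ?_
  ring

theorem hasDerivAt_eval_mul_gaussianPDFReal (q : ℝ[X]) (x : ℝ) :
    HasDerivAt (fun x => q.eval x * gaussianPDFReal 0 1 x)
      (-(gaussianPDFReal 0 1 x * (X * q - derivative q).eval x)) x := by
  refine ((q.hasDerivAt x).mul (hasDerivAt_gaussianPDFReal x)).congr_deriv ?_
  simp; ring

/-- Gaussian integration by parts against a polynomial. -/
theorem integral_deriv_mul_eval_gaussianReal {f : ℝ → ℝ}
    (hac : ∀ a b : ℝ, AbsolutelyContinuousOnInterval f a b)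
    (hf : MemLp f 2 (gaussianReal 0 1)) (hf' : MemLp (deriv f) 2 (gaussianReal 0 1)) (q : ℝ[X]) :
    ∫ x, deriv f x * q.eval x ∂(gaussianReal 0 1) =
      ∫ x, f x * (X * q - derivative q).eval x ∂(gaussianReal 0 1) := by
  set g : ℝ → ℝ := fun x => q.eval x * gaussianPDFReal 0 1 x with hg
  have hgd : deriv g = fun x => -(gaussianPDFReal 0 1 x * (X * q - derivative q).eval x) :=
    funext fun x => (hasDerivAt_eval_mul_gaussianPDFReal q x).deriv
  have hgc : ∀ a b : ℝ, AbsolutelyContinuousOnInterval g a b := fun a b => by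
    refine ContDiffOn.absolutelyContinuousOnInterval (ContDiff.contDiffOn ?_)
    rw [hg, gaussianPDFReal_def]
    exact (contDiff_eval q).mul (by fun_prop)
  have i1 := integrable_gaussianReal_iff.1 (hf.integrable_mul (memLp_eval_gaussianReal q))
  have i2 := integrable_gaussianReal_iff.1 (hf'.integrable_mul (memLp_eval_gaussianReal q))
  have i3 := integrable_gaussianReal_iff.1
    (hf.integrable_mul (memLp_eval_gaussianReal (X * q - derivative q)))
  have key := integral_eq_zero_of_sub_eq_intervalIntegral (F := fun x => f x * g x)
    (h := fun x => deriv f x * g x + f x * deriv g x)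
    (i1.congr (ae_of_all _ fun x => by simp [hg]; ring))
    ((i2.sub i3).congr (ae_of_all _ fun x => by
      simp only [hgd]; simp only [hg, Pi.sub_apply, Pi.mul_apply]; ring))
    (fun a b => ((hac a b).integral_deriv_mul_eq_sub (hgc a b)).symm)
  rw [integral_gaussianReal_eq_integral_smul one_ne_zero,
    integral_gaussianReal_eq_integral_smul one_ne_zero, ← sub_eq_zero]
  refine ((integral_sub i2 i3).symm.trans ?_).trans key
  congr 1; ext x; simp only [hgd]; simp only [Pi.mul_apply, hg]; ring

theorem integral_eval_derivative_mul_gaussianReal (p q : ℝ[X]) :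
    ∫ x, (derivative p).eval x * q.eval x ∂(gaussianReal 0 1) =
      ∫ x, p.eval x * (X * q - derivative q).eval x ∂(gaussianReal 0 1) := by
  have hd : deriv (fun x => p.eval x) = fun x => (derivative p).eval x :=
    funext fun x => p.deriv
  have := integral_deriv_mul_eval_gaussianReal (f := fun x => p.eval x)
    (fun a b => ContDiffOn.absolutelyContinuousOnInterval (contDiff_eval p).contDiffOn)
    (memLp_eval_gaussianReal p) (hd ▸ memLp_eval_gaussianReal _) q
  rwa [hd] at this

end GaussianIntegrationByParts

section GaussianMoments

theorem Real.hasSum_pow_div_factorial (y : ℝ) :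
    HasSum (fun n : ℕ => y ^ n / n.factorial) (Real.exp y) := by
  rw [Real.exp_eq_exp_ℝ]
  exact NormedSpace.expSeries_div_hasSum_exp y

theorem Complex.hasSum_pow_div_factorial (z : ℂ) :
    HasSum (fun n : ℕ => z ^ n / n.factorial) (Complex.exp z) := by
  rw [Complex.exp_eq_exp_ℂ]
  exact NormedSpace.expSeries_div_hasSum_exp z

theorem memLp_exp_abs_gaussianReal (t : ℝ) :
    MemLp (fun x : ℝ => Real.exp |t * x|) 2 (gaussianReal 0 1) := by
  rw [memLp_two_iff_integrable_sq (by fun_prop)]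
  refine ((integrable_exp_mul_gaussianReal (μ := 0) (v := 1) (2 * t)).add
    (integrable_exp_mul_gaussianReal (μ := 0) (v := 1) (-(2 * t)))).mono' (by fun_prop)
    (ae_of_all _ fun x => ?_)
  rw [Real.norm_of_nonneg (by positivity), ← Real.exp_nat_mul, Pi.add_apply]
  rcases abs_cases (t * x) with h | h <;> rw [h.1]
  · refine le_add_of_le_of_nonneg (Real.exp_le_exp.2 (le_of_eq ?_)) (Real.exp_pos _).le
    push_cast; ring
  · refine le_add_of_nonneg_of_le (Real.exp_pos _).le (Real.exp_le_exp.2 (le_of_eq ?_))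
    push_cast; ring

/-- If all moments of the square integrable `f` vanish then so does its characteristic function. -/
theorem integral_mul_cexp_eq_zero_of_moments {f : ℝ → ℝ} (hf : MemLp f 2 (gaussianReal 0 1))
    (h : ∀ n : ℕ, ∫ x, f x * x ^ n ∂(gaussianReal 0 1) = 0) (t : ℝ) :
    ∫ x, (f x : ℂ) * Complex.exp (t * x * Complex.I) ∂(gaussianReal 0 1) = 0 := by
  have hexp : ∀ x : ℝ, HasSum (fun n : ℕ => |f x| * (|t * x| ^ n / n.factorial))
      (|f x| * Real.exp |t * x|) := fun x =>
    (Real.hasSum_pow_div_factorial _).mul_left _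
  have key := hasSum_integral_of_dominated_convergence (μ := gaussianReal 0 1)
    (F := fun (n : ℕ) (x : ℝ) => (f x : ℂ) * ((t * x * Complex.I) ^ n / n.factorial))
    (f := fun x : ℝ => (f x : ℂ) * Complex.exp (t * x * Complex.I))
    (fun n x => |f x| * (|t * x| ^ n / n.factorial))
    (fun n => (Complex.continuous_ofReal.comp_aestronglyMeasurable hf.1).mul
      (by fun_prop : Continuous fun x : ℝ =>
        (t * x * Complex.I) ^ n / (n.factorial : ℂ)).aestronglyMeasurable)
    (fun n => ae_of_all _ fun x => by simp [abs_mul])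
    (ae_of_all _ fun x => (hexp x).summable)
    (by
      simp_rw [fun x => (hexp x).tsum_eq]
      exact hf.abs.integrable_mul (memLp_exp_abs_gaussianReal t))
    (ae_of_all _ fun x => (Complex.hasSum_pow_div_factorial _).mul_left _)
  have hz : ∀ n : ℕ, ∫ x, (f x : ℂ) * ((t * x * Complex.I) ^ n / n.factorial)
      ∂(gaussianReal 0 1) = 0 := fun n => by
    have : ∀ x : ℝ, (f x : ℂ) * ((t * x * Complex.I) ^ n / n.factorial) =
        ((t * Complex.I) ^ n / n.factorial) * ((f x * x ^ n : ℝ) : ℂ) := fun x => by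
      push_cast; ring
    simp_rw [this]
    rw [integral_const_mul, integral_complex_ofReal, h n]
    simp
  simp_rw [hz] at key
  exact key.unique hasSum_zero

/-- A square integrable function all of whose Gaussian moments vanish is zero. -/
theorem ae_eq_zero_of_moments {f : ℝ → ℝ} (hf : MemLp f 2 (gaussianReal 0 1))
    (h : ∀ n : ℕ, ∫ x, f x * x ^ n ∂(gaussianReal 0 1) = 0) : f =ᵐ[gaussianReal 0 1] 0 := by
  have hint : Integrable f (gaussianReal 0 1) := hf.integrable (by norm_num)
  have : IsFiniteMeasure ((gaussianReal 0 1).withDensity fun x => ENNReal.ofReal (f x)) :=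
    isFiniteMeasure_withDensity_ofReal hint.2
  have : IsFiniteMeasure ((gaussianReal 0 1).withDensity fun x => ENNReal.ofReal (-f x)) :=
    isFiniteMeasure_withDensity_ofReal hint.neg.2
  have hm1 : AEMeasurable (fun x => ENNReal.ofReal (f x)) (gaussianReal 0 1) :=
    hint.1.aemeasurable.ennreal_ofReal
  have hm2 : AEMeasurable (fun x => ENNReal.ofReal (-f x)) (gaussianReal 0 1) :=
    hint.1.aemeasurable.neg.ennreal_ofReal
  have hmul : ∀ {g : ℝ → ℝ} (_ : Integrable g (gaussianReal 0 1)) (t : ℝ),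
      Integrable (fun x => (g x : ℂ) * Complex.exp (t * x * Complex.I)) (gaussianReal 0 1) := by
    intro g hg t
    refine (hg.ofReal (𝕜 := ℂ)).mul_bdd (c := 1) (by fun_prop) (ae_of_all _ fun x => ?_)
    rw [← Complex.ofReal_mul, Complex.norm_exp_ofReal_mul_I]
  have heq : (gaussianReal 0 1).withDensity (fun x => ENNReal.ofReal (f x)) =
      (gaussianReal 0 1).withDensity fun x => ENNReal.ofReal (-f x) := by
    refine Measure.ext_of_charFun (funext fun t => ?_)
    rw [charFun_apply_real, charFun_apply_real,
      integral_withDensity_eq_integral_toReal_smul₀ hm1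
        (ae_of_all _ fun _ => ENNReal.ofReal_lt_top),
      integral_withDensity_eq_integral_toReal_smul₀ hm2
        (ae_of_all _ fun _ => ENNReal.ofReal_lt_top),
      ← sub_eq_zero, ← integral_sub, ← integral_mul_cexp_eq_zero_of_moments hf h t]
    · congr 1; ext x
      simp only [ENNReal.toReal_ofReal', Complex.real_smul, ← sub_mul, ← Complex.ofReal_sub]
      congr 2
      rcases le_total 0 (f x) with h | h
      · rw [max_eq_left h, max_eq_right (by linarith)]; ring
      · rw [max_eq_right h, max_eq_left (by linarith)]; ring
    · simpa [ENNReal.toReal_ofReal'] using hmul hint.pos_part t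
    · simpa [ENNReal.toReal_ofReal'] using hmul hint.neg_part t
  filter_upwards [(withDensity_eq_iff hm1 hm2 hint.lintegral_lt_top.ne).1 heq] with x hx
  rcases le_total 0 (f x) with h | h
  · rw [ENNReal.ofReal_of_nonpos (by linarith : -f x ≤ 0), ENNReal.ofReal_eq_zero] at hx
    exact le_antisymm hx h
  · rw [ENNReal.ofReal_of_nonpos h, eq_comm, ENNReal.ofReal_eq_zero] at hx
    exact le_antisymm h (neg_nonpos.1 hx)

end GaussianMoments

theorem MeasureTheory.MeasurePreserving.integral_comp_of_aestronglyMeasurable {α β : Type*}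
    [MeasurableSpace α] [MeasurableSpace β] {μ : Measure α} {ν : Measure β} {T : α → β}
    (hT : MeasurePreserving T μ ν) {g : β → ℝ} (hg : AEStronglyMeasurable g ν) :
    ∫ a, g (T a) ∂μ = ∫ b, g b ∂ν := by
  rw [← hT.map_eq, integral_map hT.aemeasurable (hT.map_eq.symm ▸ hg)]

section Mehler

open Polynomial

/-- The probabilists' Hermite polynomial with real coefficients. -/
noncomputable def hermiteReal (n : ℕ) : ℝ[X] := (hermite n).map (Int.castRingHom ℝ)

theorem hermiteReal_zero : hermiteReal 0 = 1 := by simp [hermiteReal]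

theorem hermiteReal_one : hermiteReal 1 = X := by simp [hermiteReal]

theorem hermiteReal_succ (n : ℕ) :
    hermiteReal (n + 1) = X * hermiteReal n - derivative (hermiteReal n) := by
  simp [hermiteReal, hermite_succ, derivative_map]

theorem derivative_hermiteReal_succ (n : ℕ) :
    derivative (hermiteReal (n + 1)) = C (n + 1 : ℝ) * hermiteReal n := by
  induction n with
  | zero => simp [hermiteReal_zero, hermiteReal_one]
  | succ n ih =>
    rw [hermiteReal_succ (n + 1), derivative_sub, derivative_mul, ih, derivative_mul,
      derivative_C, derivative_X, hermiteReal_succ n]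
    simp only [map_add, map_one, Nat.cast_add, Nat.cast_one]
    ring

/-- The second of two standard Gaussian variables with correlation `ρ`. -/
noncomputable def correlated (ρ : ℝ) (w : ℝ × ℝ) : ℝ := ρ * w.1 + √(1 - ρ ^ 2) * w.2

theorem measurePreserving_correlated {ρ : ℝ} (hρ : |ρ| ≤ 1) :
    MeasurePreserving (correlated ρ) ((gaussianReal 0 1).prod (gaussianReal 0 1))
      (gaussianReal 0 1) := by
  refine ⟨by unfold correlated; fun_prop, ?_⟩
  have hX := gaussianReal_const_mul (P := (gaussianReal 0 1).prod (gaussianReal 0 1))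
    (X := Prod.fst) ⟨by fun_prop, measurePreserving_fst.map_eq⟩ ρ
  have hY := gaussianReal_const_mul (P := (gaussianReal 0 1).prod (gaussianReal 0 1))
    (X := Prod.snd) ⟨by fun_prop, measurePreserving_snd.map_eq⟩ (√(1 - ρ ^ 2))
  have h := gaussianReal_add_gaussianReal_of_indepFun
    (indepFun_prod (μ := gaussianReal 0 1) (ν := gaussianReal 0 1)
      (X := fun x => ρ * x) (Y := fun y => √(1 - ρ ^ 2) * y) (by fun_prop) (by fun_prop))
    hX.map_eq hY.map_eq
  have h1 : 0 ≤ 1 - ρ ^ 2 := by nlinarith [abs_le.1 hρ, sq_abs ρ, abs_nonneg ρ]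
  have hm : ρ * 0 + √(1 - ρ ^ 2) * 0 = 0 := by ring
  have hv : NNReal.mk (ρ ^ 2) (sq_nonneg _) * 1 + NNReal.mk (√(1 - ρ ^ 2) ^ 2) (sq_nonneg _) * 1 =
      1 := by
    ext; simp [Real.sq_sqrt h1]
  rw [hm, hv] at h
  exact h

theorem integrable_mul_correlated {f g : ℝ → ℝ} (hf : MemLp f 2 (gaussianReal 0 1))
    (hg : MemLp g 2 (gaussianReal 0 1)) {ρ : ℝ} (hρ : |ρ| ≤ 1) :
    Integrable (fun w => f w.1 * g (correlated ρ w))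
      ((gaussianReal 0 1).prod (gaussianReal 0 1)) :=
  (hf.comp_measurePreserving measurePreserving_fst).integrable_mul
    (hg.comp_measurePreserving (measurePreserving_correlated hρ))

theorem integral_hermiteReal_succ_mul_correlated (n : ℕ) (q : ℝ[X]) {ρ : ℝ} (hρ : |ρ| ≤ 1) :
    ∫ w, (hermiteReal (n + 1)).eval w.1 * q.eval (correlated ρ w)
        ∂((gaussianReal 0 1).prod (gaussianReal 0 1)) =
      ρ * ∫ w, (hermiteReal n).eval w.1 * (derivative q).eval (correlated ρ w)
        ∂((gaussianReal 0 1).prod (gaussianReal 0 1)) := by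
  rw [integral_prod_symm _ (integrable_mul_correlated (memLp_eval_gaussianReal _)
      (memLp_eval_gaussianReal _) hρ), integral_prod_symm _ (integrable_mul_correlated
      (memLp_eval_gaussianReal _) (memLp_eval_gaussianReal _) hρ), ← integral_const_mul]
  congr 1; ext y
  have := integral_eval_derivative_mul_gaussianReal
    (q.comp (C ρ * X + C (√(1 - ρ ^ 2) * y))) (hermiteReal n)
  rw [← hermiteReal_succ] at this
  simp only [derivative_comp, eval_mul, eval_comp, eval_add, eval_C, eval_X, derivative_add,
    derivative_mul, derivative_C, derivative_X, zero_mul, zero_add, add_zero, mul_one] at this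
  rw [← integral_const_mul]
  simp only [correlated]
  calc _ = _ := by congr 1; ext x; ring
    _ = _ := this.symm
    _ = _ := by congr 1; ext x; ring

theorem integral_hermiteReal_succ (n : ℕ) :
    ∫ x, (hermiteReal (n + 1)).eval x ∂(gaussianReal 0 1) = 0 := by
  have := integral_eval_derivative_mul_gaussianReal 1 (hermiteReal n)
  rw [← hermiteReal_succ] at this
  simpa using this.symm

theorem integral_hermiteReal_mul_correlated (n m : ℕ) {ρ : ℝ} (hρ : |ρ| ≤ 1) :
    ∫ w, (hermiteReal n).eval w.1 * (hermiteReal m).eval (correlated ρ w)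
        ∂((gaussianReal 0 1).prod (gaussianReal 0 1)) =
      if n = m then ρ ^ n * n.factorial else 0 := by
  induction n generalizing m with
  | zero =>
    have h := (measurePreserving_correlated hρ).integral_comp_of_aestronglyMeasurable
      (g := fun x => (hermiteReal m).eval x) (hermiteReal m).continuous.aestronglyMeasurable
    simp only [hermiteReal_zero, eval_one, one_mul, h]
    cases m with
    | zero => simp [hermiteReal_zero]
    | succ m => simp [integral_hermiteReal_succ]
  | succ n ih =>
    rw [integral_hermiteReal_succ_mul_correlated n _ hρ]
    cases m with
    | zero => simp [hermiteReal_zero]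
    | succ m =>
      simp only [derivative_hermiteReal_succ, eval_mul, eval_C, mul_left_comm _ (m + 1 : ℝ)]
      rw [integral_const_mul, ih m]
      by_cases h : n = m
      · subst h; simp [Nat.factorial_succ]; ring
      · simp [h]

/-- The Hermite polynomials normalized in `L²` of the Gaussian measure. -/
noncomputable def normalizedHermite (n : ℕ) : ℝ[X] := C (√n.factorial)⁻¹ * hermiteReal n

/-- Mehler's formula for the Hermite polynomials. -/
theorem integral_normalizedHermite_mul_correlated (n m : ℕ) {ρ : ℝ} (hρ : |ρ| ≤ 1) :
    ∫ w, (normalizedHermite n).eval w.1 * (normalizedHermite m).eval (correlated ρ w)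
        ∂((gaussianReal 0 1).prod (gaussianReal 0 1)) = if n = m then ρ ^ n else 0 := by
  have : ∀ w : ℝ × ℝ, (normalizedHermite n).eval w.1 * (normalizedHermite m).eval (correlated ρ w) =
      ((√n.factorial)⁻¹ * (√m.factorial)⁻¹) *
        ((hermiteReal n).eval w.1 * (hermiteReal m).eval (correlated ρ w)) := fun w => by
    simp [normalizedHermite]; ring
  simp_rw [this]
  rw [integral_const_mul, integral_hermiteReal_mul_correlated n m hρ]
  split_ifs with h
  · subst h
    have h1 : (0 : ℝ) < n.factorial := by positivity
    rw [← mul_inv, Real.mul_self_sqrt h1.le]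
    field_simp
  · simp

theorem integral_normalizedHermite_mul (n m : ℕ) :
    ∫ x, (normalizedHermite n).eval x * (normalizedHermite m).eval x ∂(gaussianReal 0 1) =
      if n = m then 1 else 0 := by
  have h := integral_normalizedHermite_mul_correlated n m (ρ := 1) (by simp)
  have h' := (measurePreserving_fst (μ := gaussianReal 0 1)
    (ν := gaussianReal 0 1)).integral_comp_of_aestronglyMeasurable
    (g := fun x => (normalizedHermite n).eval x * (normalizedHermite m).eval x)
    ((normalizedHermite n).continuous.mul (normalizedHermite m).continuous).aestronglyMeasurable
  rw [← h']
  simpa [correlated] using h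

end Mehler

section HermiteExpansion

open Polynomial

/-- The coefficient of a function along the `n`-th normalized Hermite polynomial. -/
noncomputable def hermiteCoeff (f : ℝ → ℝ) (n : ℕ) : ℝ :=
  ∫ x, f x * (normalizedHermite n).eval x ∂(gaussianReal 0 1)

/-- The normalized Hermite polynomials as elements of `L²`. -/
noncomputable def hermiteLp (n : ℕ) : Lp ℝ 2 (gaussianReal 0 1) :=
  (memLp_eval_gaussianReal (normalizedHermite n)).toLp _

theorem inner_toLp_toLp {α : Type*} [MeasurableSpace α] {μ : Measure α} {f g : α → ℝ}
    (hf : MemLp f 2 μ) (hg : MemLp g 2 μ) :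
    inner ℝ (hf.toLp f) (hg.toLp g) = ∫ a, f a * g a ∂μ := by
  rw [L2.inner_def]
  refine integral_congr_ae ?_
  filter_upwards [hf.coeFn_toLp, hg.coeFn_toLp] with a h1 h2
  rw [h1, h2]
  simp [mul_comm]

theorem orthonormal_hermiteLp : Orthonormal ℝ hermiteLp := by
  rw [orthonormal_iff_ite]
  intro n m
  rw [hermiteLp, hermiteLp, inner_toLp_toLp, integral_normalizedHermite_mul]

theorem hermiteCoeff_eq (f : ℝ → ℝ) (n : ℕ) : hermiteCoeff f n =
    (√n.factorial)⁻¹ * ∫ x, f x * (hermiteReal n).eval x ∂(gaussianReal 0 1) := by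
  rw [hermiteCoeff, ← integral_const_mul]
  congr 1; ext x; simp [normalizedHermite]; ring

/-- A square integrable function orthogonal to all Hermite polynomials is zero. -/
theorem ae_eq_zero_of_hermiteCoeff {f : ℝ → ℝ} (hf : MemLp f 2 (gaussianReal 0 1))
    (h : ∀ n, hermiteCoeff f n = 0) : f =ᵐ[gaussianReal 0 1] 0 := by
  have h0 : ∀ n, ∫ x, f x * (hermiteReal n).eval x ∂(gaussianReal 0 1) = 0 := fun n => by
    have := h n
    rw [hermiteCoeff_eq, mul_eq_zero] at this
    exact this.resolve_left (by positivity)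
  have hX : ∀ n : ℕ, X * hermiteReal n =
      hermiteReal (n + 1) + C (n : ℝ) * hermiteReal (n - 1) := fun n => by
    rw [hermiteReal_succ]
    cases n with
    | zero => simp [hermiteReal_zero]
    | succ n => rw [derivative_hermiteReal_succ]; simp
  have key : ∀ k n : ℕ, ∫ x, f x * (X ^ k * hermiteReal n).eval x ∂(gaussianReal 0 1) = 0 := by
    intro k
    induction k with
    | zero => simpa using h0
    | succ k ih =>
      intro n
      have : ∀ x, f x * (X ^ (k + 1) * hermiteReal n).eval x =
          f x * (X ^ k * hermiteReal (n + 1)).eval x +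
            n * (f x * (X ^ k * hermiteReal (n - 1)).eval x) := fun x => by
        rw [pow_succ, mul_assoc, hX n]
        simp; ring
      simp_rw [this]
      have hi : ∀ p : ℝ[X], Integrable (fun x => f x * p.eval x) (gaussianReal 0 1) := fun p =>
        hf.integrable_mul (memLp_eval_gaussianReal p)
      rw [integral_add (hi _) ((hi _).const_mul _), integral_const_mul, ih, ih]
      simp
  refine ae_eq_zero_of_moments hf fun n => ?_
  simpa [hermiteReal_zero] using key n 0

theorem span_hermiteLp_orthogonal : (Submodule.span ℝ (Set.range hermiteLp))ᗮ = ⊥ := by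
  rw [Submodule.eq_bot_iff]
  intro f hf
  refine Lp.eq_zero_iff_ae_eq_zero.2 (ae_eq_zero_of_hermiteCoeff (Lp.memLp f) fun n => ?_)
  have := (Submodule.mem_orthogonal _ _).1 hf _ (Submodule.subset_span ⟨n, rfl⟩)
  rw [real_inner_comm] at this
  rwa [hermiteLp, ← Lp.toLp_coeFn f (Lp.memLp f), inner_toLp_toLp] at this

/-- The Hilbert basis of normalized Hermite polynomials. -/
noncomputable def hermiteBasis : HilbertBasis ℕ ℝ (Lp ℝ 2 (gaussianReal 0 1)) :=
  HilbertBasis.mkOfOrthogonalEqBot orthonormal_hermiteLp span_hermiteLp_orthogonal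

/-- Mehler's formula: the dual activation has the power series whose coefficients are the squared
Hermite coefficients. -/
theorem hasSum_dualActivation {φ : ℝ → ℝ} (hφ : MemLp φ 2 (gaussianReal 0 1)) {ρ : ℝ}
    (hρ : |ρ| ≤ 1) : HasSum (fun n => hermiteCoeff φ n ^ 2 * ρ ^ n) (dualActivation φ ρ) := by
  set A := Lp.compMeasurePreservingₗᵢ (E := ℝ) (p := 2) ℝ Prod.fst
    (measurePreserving_fst (μ := gaussianReal 0 1) (ν := gaussianReal 0 1))
  set B := Lp.compMeasurePreservingₗᵢ (E := ℝ) (p := 2) ℝ (correlated ρ)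
    (measurePreserving_correlated hρ)
  have hAB : ∀ {f g : ℝ → ℝ} (hf : MemLp f 2 (gaussianReal 0 1))
      (hg : MemLp g 2 (gaussianReal 0 1)), inner ℝ (A (hf.toLp f)) (B (hg.toLp g)) =
        ∫ w, f w.1 * g (correlated ρ w) ∂((gaussianReal 0 1).prod (gaussianReal 0 1)) :=
    fun hf hg => inner_toLp_toLp (hf.comp_measurePreserving measurePreserving_fst)
      (hg.comp_measurePreserving (measurePreserving_correlated hρ))
  have hb : ∀ n, hermiteBasis n = hermiteLp n := fun n => by
    rw [hermiteBasis, HilbertBasis.coe_mkOfOrthogonalEqBot]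
  have hc : ∀ n, hermiteBasis.repr (hφ.toLp φ) n = hermiteCoeff φ n := fun n => by
    rw [HilbertBasis.repr_apply_apply, hb, real_inner_comm, hermiteLp, inner_toLp_toLp]
    rfl
  have hs := hermiteBasis.hasSum_repr (hφ.toLp φ)
  simp only [hc, hb] at hs
  have hee : ∀ n m, inner ℝ (A (hermiteLp n)) (B (hermiteLp m)) = if n = m then ρ ^ n else 0 :=
    fun n m => by
      rw [hermiteLp, hermiteLp, hAB, integral_normalizedHermite_mul_correlated n m hρ]
  have heφ : ∀ n, inner ℝ (A (hermiteLp n)) (B (hφ.toLp φ)) = hermiteCoeff φ n * ρ ^ n := fun n => by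
    have h1 := (hs.mapL (B.toContinuousLinearMap)).mapL (innerSL ℝ (A (hermiteLp n)))
    simp only [map_smul, LinearIsometry.coe_toContinuousLinearMap, innerSL_apply_apply, hee,
      smul_eq_mul] at h1
    refine h1.unique ?_
    convert hasSum_single n fun m hm => ?_ using 1
    · simp
    · simp [hm.symm]
  have h2 := (hs.mapL (A.toContinuousLinearMap)).mapL (innerSL ℝ (B (hφ.toLp φ)))
  simp only [map_smul, LinearIsometry.coe_toContinuousLinearMap, innerSL_apply_apply,
    smul_eq_mul, real_inner_comm _ (B (hφ.toLp φ))] at h2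
  rw [hAB] at h2
  simp only [heφ, ← mul_assoc, ← sq] at h2
  exact h2

end HermiteExpansion

section PowerSeriesBounds

theorem abs_le_of_hasSum_pow {c : ℕ → ℝ} (hc : ∀ n, 0 ≤ c n) {ρ S T : ℝ} (hρ : |ρ| ≤ 1)
    (hS : HasSum (fun n => c n * ρ ^ n) S) (hT : HasSum c T) :
    |S| ≤ c 0 + (T - c 0) * |ρ| := by
  have hd : HasSum (fun n => c n * |ρ| + if n = 0 then c 0 * (1 - |ρ|) else 0)
      (T * |ρ| + c 0 * (1 - |ρ|)) := (hT.mul_right _).add (hasSum_ite_eq 0 _)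
  have hle : ∀ n, |c n * ρ ^ n| ≤ c n * |ρ| + if n = 0 then c 0 * (1 - |ρ|) else 0 := by
    intro n
    rw [abs_mul, abs_of_nonneg (hc n), abs_pow]
    split_ifs with h
    · subst h; simp; linarith
    · have := mul_le_mul_of_nonneg_left (pow_le_of_le_one (abs_nonneg ρ) hρ h) (hc n)
      linarith
  have : |S| ≤ T * |ρ| + c 0 * (1 - |ρ|) := abs_le.2
    ⟨hasSum_le (fun n => (abs_le.1 (hle n)).1) hd.neg hS,
      hasSum_le (fun n => (abs_le.1 (hle n)).2) hS hd⟩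
  linarith

theorem abs_le_of_hasSum_pow_of_zero {c : ℕ → ℝ} (hc : ∀ n, 0 ≤ c n) (h0 : c 0 = 0) {ρ S T : ℝ}
    (hρ : |ρ| ≤ 1) (hS : HasSum (fun n => c n * ρ ^ n) S) (hT : HasSum c T) :
    |S| ≤ c 1 * |ρ| + (T - c 1) * |ρ| ^ 2 := by
  have hd : HasSum (fun n => c n * |ρ| ^ 2 + if n = 1 then c 1 * (|ρ| - |ρ| ^ 2) else 0)
      (T * |ρ| ^ 2 + c 1 * (|ρ| - |ρ| ^ 2)) := (hT.mul_right _).add (hasSum_ite_eq 1 _)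
  have hle : ∀ n, |c n * ρ ^ n| ≤
      c n * |ρ| ^ 2 + if n = 1 then c 1 * (|ρ| - |ρ| ^ 2) else 0 := by
    intro n
    rw [abs_mul, abs_of_nonneg (hc n), abs_pow]
    rcases n with _ | _ | n
    · simp [h0]
    · simp; linarith
    · have := mul_le_mul_of_nonneg_left
        (pow_le_pow_of_le_one (abs_nonneg ρ) hρ (by omega : 2 ≤ n + 1 + 1)) (hc (n + 1 + 1))
      simpa using this
  have : |S| ≤ T * |ρ| ^ 2 + c 1 * (|ρ| - |ρ| ^ 2) := abs_le.2
    ⟨hasSum_le (fun n => (abs_le.1 (hle n)).1) hd.neg hS,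
      hasSum_le (fun n => (abs_le.1 (hle n)).2) hS hd⟩
  linarith

end PowerSeriesBounds

section Activation

open Polynomial

theorem dualActivation_one {φ : ℝ → ℝ} (hφ : MemLp φ 2 (gaussianReal 0 1)) :
    dualActivation φ 1 = ∫ x, φ x ^ 2 ∂(gaussianReal 0 1) := by
  rw [← (measurePreserving_fst (μ := gaussianReal 0 1)
    (ν := gaussianReal 0 1)).integral_comp_of_aestronglyMeasurable
      (g := fun x => φ x ^ 2) (hφ.1.pow 2)]
  simp [dualActivation, sq]

theorem hasSum_hermiteCoeff_sq {φ : ℝ → ℝ} (hφ : MemLp φ 2 (gaussianReal 0 1)) :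
    HasSum (fun n => hermiteCoeff φ n ^ 2) (dualActivation φ 1) := by
  simpa using hasSum_dualActivation hφ (ρ := 1) (by simp)

namespace IsNormalizedActivation

variable {σ : ℝ → ℝ}

theorem dualActivation_one (hσ : IsNormalizedActivation σ) : dualActivation σ 1 = 1 := by
  rw [_root_.dualActivation_one hσ.memLp, ← hσ.variance_eq_one,
    variance_of_integral_eq_zero hσ.memLp.1.aemeasurable hσ.mean_eq_zero]

theorem hermiteCoeff_deriv (hσ : IsNormalizedActivation σ) (n : ℕ) :
    hermiteCoeff (deriv σ) n = √(n + 1) * hermiteCoeff σ (n + 1) := by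
  rw [hermiteCoeff_eq, hermiteCoeff_eq, integral_deriv_mul_eval_gaussianReal
    hσ.absolutelyContinuous hσ.memLp hσ.memLp_deriv, ← hermiteReal_succ, ← mul_assoc]
  congr 1
  have h : (0 : ℝ) < √(n + 1) := Real.sqrt_pos.2 (by positivity)
  rw [Nat.factorial_succ, Nat.cast_mul, Real.sqrt_mul (by positivity), mul_inv, ← mul_assoc,
    Nat.cast_succ, mul_inv_cancel₀ h.ne', one_mul]

theorem hermiteCoeff_zero (hσ : IsNormalizedActivation σ) : hermiteCoeff σ 0 = 0 := by
  rw [hermiteCoeff_eq]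
  simp [hermiteReal_zero, hσ.mean_eq_zero]

theorem hermiteCoeff_one_sq : hermiteCoeff σ 1 ^ 2 = 1 - nonlinearityCoeff σ := by
  rw [hermiteCoeff_eq, nonlinearityCoeff]
  simp [hermiteReal_one, mul_comm]

theorem nonlinearityCoeff_le_one : nonlinearityCoeff σ ≤ 1 := by
  have := sq_nonneg (hermiteCoeff σ 1)
  rw [hermiteCoeff_one_sq] at this
  linarith

theorem abs_dualActivation_le (hσ : IsNormalizedActivation σ) {ρ : ℝ} (hρ : |ρ| ≤ 1) :
    |dualActivation σ ρ| ≤ |ρ| * (1 - nonlinearityCoeff σ * (1 - |ρ|)) := by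
  have h := abs_le_of_hasSum_pow_of_zero (fun n => sq_nonneg (hermiteCoeff σ n))
    (by simp [hσ.hermiteCoeff_zero]) hρ (hasSum_dualActivation hσ.memLp hρ)
    (hasSum_hermiteCoeff_sq hσ.memLp)
  rw [hσ.dualActivation_one, hermiteCoeff_one_sq] at h
  linarith

/-- The Gaussian Poincaré inequality for a normalized activation. -/
theorem one_le_dualActivation_deriv_one (hσ : IsNormalizedActivation σ) :
    1 ≤ dualActivation (deriv σ) 1 := by
  have h1 : HasSum (fun n => hermiteCoeff σ (n + 1) ^ 2) 1 := by
    have := hasSum_hermiteCoeff_sq hσ.memLp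
    rw [hσ.dualActivation_one] at this
    refine ((hasSum_nat_add_iff' 1).2 this).trans_eq ?_
    simp [hσ.hermiteCoeff_zero]
  refine hasSum_le (fun n => ?_) h1 (hasSum_hermiteCoeff_sq hσ.memLp_deriv)
  rw [hσ.hermiteCoeff_deriv, mul_pow, Real.sq_sqrt (by positivity)]
  nlinarith [sq_nonneg (hermiteCoeff σ (n + 1)), (Nat.cast_nonneg n : (0 : ℝ) ≤ n)]

theorem abs_dualActivation_deriv_le (hσ : IsNormalizedActivation σ) {ρ : ℝ} (hρ : |ρ| ≤ 1) :
    |dualActivation (deriv σ) ρ| ≤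
      dualActivation (deriv σ) 1 * (1 - nonlinearityCoeff σ * (1 - |ρ|)) := by
  have h := abs_le_of_hasSum_pow (fun n => sq_nonneg (hermiteCoeff (deriv σ) n)) hρ
    (hasSum_dualActivation hσ.memLp_deriv hρ) (hasSum_hermiteCoeff_sq hσ.memLp_deriv)
  rw [hσ.hermiteCoeff_deriv 0] at h
  simp only [Nat.cast_zero, zero_add, Real.sqrt_one, one_mul, hermiteCoeff_one_sq] at h
  nlinarith [mul_nonneg (mul_nonneg (sub_nonneg.2 hρ)
    (sub_nonneg.2 (nonlinearityCoeff_le_one (σ := σ))))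
    (sub_nonneg.2 hσ.one_le_dualActivation_deriv_one)]

end IsNormalizedActivation

end Activation

section CorrelationMap

/-- The quadratic map `r ↦ (1 - μ) r + μ r²`, which majorizes the dual activations whose coefficient
of nonlinearity is `μ`. -/
def corrMap (μ r : ℝ) : ℝ := r * (1 - μ * (1 - r))

variable {μ : ℝ}

theorem corrMap_mono (h0 : 0 ≤ μ) (h1 : μ ≤ 1) {r s : ℝ} (hr : 0 ≤ r) (hrs : r ≤ s) :
    corrMap μ r ≤ corrMap μ s := by
  have : 0 ≤ (s - r) * (1 - μ + μ * (r + s)) :=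
    mul_nonneg (by linarith) (add_nonneg (by linarith) (mul_nonneg h0 (by linarith)))
  unfold corrMap
  linarith

theorem corrMap_mem (h0 : 0 ≤ μ) (h1 : μ ≤ 1) {r : ℝ} (hr : r ∈ Set.Icc (0 : ℝ) 1) :
    corrMap μ r ∈ Set.Icc 0 r := by
  have h2 : μ * (1 - r) ≤ 1 := mul_le_one₀ h1 (by linarith [hr.2]) (by linarith [hr.1])
  exact ⟨mul_nonneg hr.1 (by linarith),
    mul_le_of_le_one_right hr.1 (by linarith [mul_nonneg h0 (sub_nonneg.2 hr.2)])⟩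

theorem iterate_corrMap_mem (h0 : 0 ≤ μ) (h1 : μ ≤ 1) {r : ℝ} (hr : r ∈ Set.Icc (0 : ℝ) 1)
    (l : ℕ) : (corrMap μ)^[l] r ∈ Set.Icc 0 r := by
  induction l with
  | zero => exact ⟨hr.1, le_rfl⟩
  | succ l ih =>
    rw [Function.iterate_succ_apply']
    have := corrMap_mem h0 h1 ⟨ih.1, ih.2.trans hr.2⟩
    exact ⟨this.1, this.2.trans ih.2⟩

theorem iterate_corrMap_antitone (h0 : 0 ≤ μ) (h1 : μ ≤ 1) {r : ℝ} (hr : r ∈ Set.Icc (0 : ℝ) 1) :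
    Antitone fun l => (corrMap μ)^[l] r := by
  refine antitone_nat_of_succ_le fun l => ?_
  rw [Function.iterate_succ_apply']
  have := iterate_corrMap_mem h0 h1 hr l
  exact (corrMap_mem h0 h1 ⟨this.1, this.2.trans hr.2⟩).2

/-- The odds `r / (1 - r)` contract by the factor `1 - μ / 2`. -/
theorem iterate_corrMap_div_le (h0 : 0 ≤ μ) (h1 : μ ≤ 1) {r : ℝ} (hr : 0 ≤ r) (hr1 : r < 1)
    (l : ℕ) : (corrMap μ)^[l] r / (1 - (corrMap μ)^[l] r) ≤ (1 - μ / 2) ^ l * (r / (1 - r)) := by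
  induction l with
  | zero => simp
  | succ l ih =>
    rw [Function.iterate_succ_apply', pow_succ', mul_assoc]
    refine le_trans ?_ (mul_le_mul_of_nonneg_left ih (by linarith))
    have hs := iterate_corrMap_mem h0 h1 ⟨hr, hr1.le⟩ l
    set s := (corrMap μ)^[l] r
    have hs1 : 0 < 1 - s := by linarith [hs.2]
    have hf : 1 - corrMap μ s = (1 - s) * (1 + μ * s) := by unfold corrMap; ring
    have hp : 0 < 1 + μ * s := by linarith [mul_nonneg h0 hs.1]
    have hq : 1 - μ * (1 - s) ≤ (1 - μ / 2) * (1 + μ * s) := by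
      have h3 : μ * s ≤ 1 := mul_le_one₀ h1 hs.1 (by linarith)
      linarith [mul_nonneg h0 (sub_nonneg.2 h3)]
    rw [hf, div_le_iff₀ (mul_pos hs1 hp), corrMap]
    calc s * (1 - μ * (1 - s)) ≤ s * ((1 - μ / 2) * (1 + μ * s)) :=
          mul_le_mul_of_nonneg_left hq hs.1
      _ = (1 - μ / 2) * (s / (1 - s)) * ((1 - s) * (1 + μ * s)) := by field_simp

/-- Beyond the convergence depth the iterated correlation map is at most `n⁻⁴`. -/
theorem iterate_corrMap_le_of_convDepth_le (h0 : 0 < μ) (h1 : μ ≤ 1) {n : ℕ} (hn : 1 ≤ n) {δ : ℝ}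
    (hδ : 0 < δ) (hδ1 : δ ≤ 1) {L : ℕ} (hL : convDepth n δ μ ≤ L) {r : ℝ} (hr : 0 ≤ r)
    (hr1 : r ≤ 1 - δ) : (corrMap μ)^[L] r ≤ 1 / (n : ℝ) ^ 4 := by
  have hn0 : (0 : ℝ) < n := by exact_mod_cast hn
  have hs := iterate_corrMap_mem h0.le h1 ⟨hr, by linarith⟩ L
  have h2 := iterate_corrMap_div_le h0.le h1 hr (by linarith) L
  set s := (corrMap μ)^[L] r
  have h3 : s ≤ s / (1 - s) := le_div_self hs.1 (by linarith [hs.2]) (by linarith [hs.1])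
  have h4 : r / (1 - r) ≤ 1 / δ := div_le_div₀ zero_le_one (by linarith) hδ (by linarith)
  have h5 : (1 - μ / 2) ^ L ≤ (δ / n) ^ 4 := by
    calc (1 - μ / 2) ^ L ≤ Real.exp (-(μ / 2)) ^ L :=
          pow_le_pow_left₀ (by linarith) (by linarith [Real.add_one_le_exp (-(μ / 2))]) L
      _ = Real.exp (-(μ * L / 2)) := by rw [← Real.exp_nat_mul]; congr 1; ring
      _ ≤ Real.exp (-(4 * Real.log (n / δ))) := by
          refine Real.exp_le_exp.2 (neg_le_neg ?_)
          rw [convDepth, div_le_iff₀ h0] at hL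
          linarith
      _ = (δ / n) ^ 4 := by
          have : -(4 * Real.log (n / δ)) = (4 : ℕ) * Real.log (δ / n) := by
            rw [← inv_div, Real.log_inv]; push_cast; ring
          rw [this, Real.exp_nat_mul, Real.exp_log (by positivity)]
  calc s ≤ (1 - μ / 2) ^ L * (r / (1 - r)) := h3.trans h2
    _ ≤ (δ / n) ^ 4 * (1 / δ) :=
        mul_le_mul h5 h4 (div_nonneg hr (by linarith)) (by positivity)
    _ = δ ^ 3 / (n : ℝ) ^ 4 := by field_simp
    _ ≤ 1 / (n : ℝ) ^ 4 := by gcongr; exact pow_le_one₀ hδ.le hδ1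

end CorrelationMap

section Kernel

namespace IsNormalizedActivation

variable {σ : ℝ → ℝ}

theorem abs_iterate_dualActivation_le (hσ : IsNormalizedActivation σ)
    (hμ : 0 < nonlinearityCoeff σ) {ρ : ℝ} (hρ : |ρ| ≤ 1) (l : ℕ) :
    |(dualActivation σ)^[l] ρ| ≤ (corrMap (nonlinearityCoeff σ))^[l] |ρ| := by
  induction l with
  | zero => simp
  | succ l ih =>
    have hm := iterate_corrMap_mem hμ.le nonlinearityCoeff_le_one ⟨abs_nonneg ρ, hρ⟩ l
    rw [Function.iterate_succ_apply', Function.iterate_succ_apply']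
    exact (hσ.abs_dualActivation_le (ih.trans (hm.2.trans hρ))).trans
      (corrMap_mono hμ.le nonlinearityCoeff_le_one (abs_nonneg _) ih)

theorem ntk_one (hσ : IsNormalizedActivation σ) (τ : Fin 2) (L : ℕ) :
    ntk σ τ L 1 = ∑ h ∈ Finset.Icc 1 (L + 1), dualActivation (deriv σ) 1 ^ (L + 1 - h) := by
  simp [ntk, Function.iterate_fixed hσ.dualActivation_one]

theorem ntk_one_pos (hσ : IsNormalizedActivation σ) (τ : Fin 2) (L : ℕ) : 0 < ntk σ τ L 1 := by
  have := hσ.one_le_dualActivation_deriv_one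
  rw [hσ.ntk_one]
  exact Finset.sum_pos (fun h _ => by positivity) ⟨1, by simp⟩

/-- The normalized kernel decays with depth at least as fast as the iterated correlation map. -/
theorem abs_ntk_le (hσ : IsNormalizedActivation σ) (hμ : 0 < nonlinearityCoeff σ) (τ : Fin 2)
    (L : ℕ) {ρ : ℝ} (hρ : |ρ| ≤ 1) :
    |ntk σ τ L ρ| ≤ ntk σ τ L 1 * (corrMap (nonlinearityCoeff σ))^[L] |ρ| := by
  set μ := nonlinearityCoeff σ
  set s := dualActivation (deriv σ) 1
  have hμ1 : μ ≤ 1 := nonlinearityCoeff_le_one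
  have hs1 : 1 ≤ s := hσ.one_le_dualActivation_deriv_one
  have hr : |ρ| ∈ Set.Icc (0 : ℝ) 1 := ⟨abs_nonneg ρ, hρ⟩
  have hfac : ∀ h' : ℕ, |dualActivation (deriv σ) ((dualActivation σ)^[h' - (τ : ℕ)] ρ)| ≤
      s * (1 - μ * (1 - (corrMap μ)^[h' - 1] |ρ|)) := by
    intro h'
    have h1 := hσ.abs_iterate_dualActivation_le hμ hρ (h' - (τ : ℕ))
    have h2 := iterate_corrMap_antitone hμ.le hμ1 hr (show h' - 1 ≤ h' - (τ : ℕ) by omega)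
    have h3 := iterate_corrMap_mem hμ.le hμ1 hr (h' - (τ : ℕ))
    refine (hσ.abs_dualActivation_deriv_le (h1.trans (h3.2.trans hρ))).trans ?_
    have : |(dualActivation σ)^[h' - (τ : ℕ)] ρ| ≤ (corrMap μ)^[h' - 1] |ρ| := h1.trans h2
    gcongr
  have hprod : ∀ k m : ℕ, (corrMap μ)^[k] |ρ| *
      ∏ h' ∈ Finset.Ico (k + 1) (k + 1 + m), s * (1 - μ * (1 - (corrMap μ)^[h' - 1] |ρ|)) =
        s ^ m * (corrMap μ)^[k + m] |ρ| := by
    intro k m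
    induction m with
    | zero => simp
    | succ m ih =>
      rw [← add_assoc, Finset.prod_Ico_succ_top (by omega), ← mul_assoc, ih, ← add_assoc,
        Function.iterate_succ_apply', show k + 1 + m - 1 = k + m by omega]
      simp only [corrMap]
      ring
  rw [hσ.ntk_one, Finset.sum_mul, ntk]
  refine (Finset.abs_sum_le_sum_abs _ _).trans (Finset.sum_le_sum fun h hh => ?_)
  obtain ⟨h1, h2⟩ := Finset.mem_Icc.1 hh
  have hIcc : Finset.Icc h L = Finset.Ico (h - 1 + 1) (h - 1 + 1 + (L + 1 - h)) := by
    ext i; simp only [Finset.mem_Icc, Finset.mem_Ico]; omega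
  rw [abs_mul, Finset.abs_prod]
  calc _ ≤ (corrMap μ)^[h - 1] |ρ| *
        ∏ h' ∈ Finset.Icc h L, s * (1 - μ * (1 - (corrMap μ)^[h' - 1] |ρ|)) :=
        mul_le_mul (hσ.abs_iterate_dualActivation_le hμ hρ _)
          (Finset.prod_le_prod (fun _ _ => abs_nonneg _) fun h' _ => hfac h')
          (Finset.prod_nonneg fun _ _ => abs_nonneg _) (iterate_corrMap_mem hμ.le hμ1 hr _).1
    _ = s ^ (L + 1 - h) * (corrMap μ)^[L] |ρ| := by
        rw [hIcc, hprod, show h - 1 + (L + 1 - h) = L by omega]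

theorem abs_ntk_le_one (hσ : IsNormalizedActivation σ) (hμ : 0 < nonlinearityCoeff σ) (τ : Fin 2)
    (L : ℕ) {ρ : ℝ} (hρ : |ρ| ≤ 1) : |ntk σ τ L ρ| ≤ ntk σ τ L 1 :=
  (hσ.abs_ntk_le hμ τ L hρ).trans (mul_le_of_le_one_right (hσ.ntk_one_pos τ L).le
    ((iterate_corrMap_mem hμ.le nonlinearityCoeff_le_one ⟨abs_nonneg ρ, hρ⟩ L).2.trans hρ))

end IsNormalizedActivation

end Kernel

section MatrixPerturbation

variable {ι : Type*} [Fintype ι]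

theorem EuclideanSpace.norm_toLp_sq (v : ι → ℝ) : ‖WithLp.toLp 2 v‖ ^ 2 = v ⬝ᵥ v := by
  rw [EuclideanSpace.norm_sq_eq]
  simp [dotProduct, sq]

theorem EuclideanSpace.norm_toLp_le {v : ι → ℝ} {b : ℝ} (hb : 0 ≤ b) (h : ∀ i, |v i| ≤ b) :
    ‖WithLp.toLp 2 v‖ ≤ √(Fintype.card ι) * b := by
  refine abs_le_of_sq_le_sq' ?_ (by positivity) |>.2
  rw [norm_toLp_sq, mul_pow, Real.sq_sqrt (by positivity), dotProduct]
  calc ∑ i, v i * v i ≤ ∑ _i : ι, b ^ 2 := Finset.sum_le_sum fun i _ => by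
        rw [← sq, ← sq_abs]; exact pow_le_pow_left₀ (abs_nonneg _) (h i) 2
    _ = _ := by simp

theorem abs_dotProduct_le (v w : ι → ℝ) :
    |v ⬝ᵥ w| ≤ ‖WithLp.toLp 2 v‖ * ‖WithLp.toLp 2 w‖ := by
  have := abs_real_inner_le_norm (WithLp.toLp 2 w) (WithLp.toLp 2 v)
  rw [mul_comm, EuclideanSpace.inner_toLp_toLp] at this
  simpa using this

variable [DecidableEq ι]

theorem Matrix.abs_dotProduct_mulVec_le (A : Matrix ι ι ℝ) (v w : ι → ℝ) :
    |v ⬝ᵥ (A *ᵥ w)| ≤ ‖WithLp.toLp 2 v‖ * (‖A‖ * ‖WithLp.toLp 2 w‖) :=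
  (abs_dotProduct_le _ _).trans
    (mul_le_mul_of_nonneg_left (A.l2_opNorm_mulVec (WithLp.toLp 2 w)) (norm_nonneg _))

theorem Matrix.l2_opNorm_le_of_abs_le {A : Matrix ι ι ℝ} {e : ℝ} (he : 0 ≤ e)
    (h : ∀ i j, |A i j| ≤ e) : ‖A‖ ≤ Fintype.card ι * e := by
  rw [Matrix.cstar_norm_def]
  refine ContinuousLinearMap.opNorm_le_bound _ (by positivity) fun w => ?_
  have hrow : ∀ i, |(A *ᵥ w.ofLp) i| ≤ √(Fintype.card ι) * e * ‖w‖ := fun i =>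
    (abs_dotProduct_le (A i) w.ofLp).trans
      (mul_le_mul_of_nonneg_right (EuclideanSpace.norm_toLp_le he (h i)) (norm_nonneg _))
  calc ‖Matrix.toEuclideanCLM (n := ι) (𝕜 := ℝ) A w‖ = ‖WithLp.toLp 2 (A *ᵥ w.ofLp)‖ := rfl
    _ ≤ √(Fintype.card ι) * (√(Fintype.card ι) * e * ‖w‖) :=
        EuclideanSpace.norm_toLp_le (by positivity) hrow
    _ = Fintype.card ι * e * ‖w‖ := by
        rw [← mul_assoc, ← mul_assoc, Real.mul_self_sqrt (by positivity)]

variable {K : Matrix ι ι ℝ} {a : ℝ}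

theorem Matrix.le_dotProduct_mulVec_of_norm_sub_le (h : ‖K - a • (1 : Matrix ι ι ℝ)‖ ≤ a / 2)
    (v : ι → ℝ) : a / 2 * (v ⬝ᵥ v) ≤ v ⬝ᵥ (K *ᵥ v) := by
  have h1 := (abs_le.1 ((K - a • (1 : Matrix ι ι ℝ)).abs_dotProduct_mulVec_le v v)).1
  rw [Matrix.sub_mulVec, Matrix.smul_mulVec, Matrix.one_mulVec, dotProduct_sub,
    dotProduct_smul, smul_eq_mul] at h1
  have h2 := EuclideanSpace.norm_toLp_sq v
  have h3 := mul_le_mul_of_nonneg_right h (sq_nonneg ‖WithLp.toLp 2 v‖)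
  rw [h2] at h3
  have h4 : ‖WithLp.toLp 2 v‖ * (‖K - a • (1 : Matrix ι ι ℝ)‖ * ‖WithLp.toLp 2 v‖) =
      ‖K - a • (1 : Matrix ι ι ℝ)‖ * (v ⬝ᵥ v) := by rw [← h2]; ring
  rw [h4] at h1
  linarith

theorem Matrix.isUnit_of_norm_sub_le (ha : 0 < a) (h : ‖K - a • (1 : Matrix ι ι ℝ)‖ ≤ a / 2) :
    IsUnit K := by
  rw [← Matrix.mulVec_injective_iff_isUnit]
  refine (injective_iff_map_eq_zero (Matrix.mulVecLin K)).2 fun v hv => ?_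
  have h1 := Matrix.le_dotProduct_mulVec_of_norm_sub_le h v
  rw [show K *ᵥ v = 0 from hv, dotProduct_zero] at h1
  have h2 : 0 ≤ v ⬝ᵥ v := by rw [← EuclideanSpace.norm_toLp_sq]; positivity
  exact dotProduct_self_eq_zero.1 (by nlinarith)

theorem Matrix.inv_smul_one (ha : a ≠ 0) :
    (a • (1 : Matrix ι ι ℝ))⁻¹ = a⁻¹ • (1 : Matrix ι ι ℝ) :=
  Matrix.inv_eq_right_inv (by simp [smul_smul, inv_mul_cancel₀ ha])

theorem Matrix.inv_smul_one_sub_inv (ha : a ≠ 0) (hK : IsUnit K) :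
    (a • (1 : Matrix ι ι ℝ))⁻¹ - K⁻¹ = a⁻¹ • ((K - a • (1 : Matrix ι ι ℝ)) * K⁻¹) := by
  rw [Matrix.inv_smul_one ha, sub_mul, Matrix.mul_nonsing_inv _ ((Matrix.isUnit_iff_isUnit_det _).1 hK), smul_sub]
  simp [smul_smul, inv_mul_cancel₀ ha]

theorem Matrix.norm_inv_smul_one_sub_inv_le (ha : 0 < a) (hK : IsUnit K) :
    ‖(a • (1 : Matrix ι ι ℝ))⁻¹ - K⁻¹‖ ≤
      a⁻¹ * (‖K - a • (1 : Matrix ι ι ℝ)‖ * ‖K⁻¹‖) := by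
  rw [Matrix.inv_smul_one_sub_inv ha.ne' hK, norm_smul, Real.norm_of_nonneg (by positivity)]
  exact mul_le_mul_of_nonneg_left (norm_mul_le _ _) (by positivity)

theorem Matrix.norm_inv_le_of_norm_sub_le [Nonempty ι] (ha : 0 < a)
    (h : ‖K - a • (1 : Matrix ι ι ℝ)‖ ≤ a / 2) : ‖K⁻¹‖ ≤ 2 * a⁻¹ := by
  have hK := Matrix.isUnit_of_norm_sub_le ha h
  have h1 := Matrix.norm_inv_smul_one_sub_inv_le ha hK
  have h2 : ‖(a • (1 : Matrix ι ι ℝ))⁻¹‖ = a⁻¹ := by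
    rw [Matrix.inv_smul_one ha.ne', norm_smul, norm_one, mul_one, Real.norm_of_nonneg (by positivity)]
  have h3 := norm_sub_norm_le K⁻¹ (a • (1 : Matrix ι ι ℝ))⁻¹
  rw [norm_sub_rev, h2] at h3
  have h4 : a⁻¹ * (‖K - a • (1 : Matrix ι ι ℝ)‖ * ‖K⁻¹‖) ≤ a⁻¹ * (a / 2 * ‖K⁻¹‖) := by gcongr
  have h5 : a⁻¹ * (a / 2 * ‖K⁻¹‖) = ‖K⁻¹‖ / 2 := by field_simp
  linarith

end MatrixPerturbation

section LinearDynamics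

variable {ι : Type*} [Fintype ι] {K : Matrix ι ι ℝ} {c : ℝ} {v : ℝ → ι → ℝ}

/-- Solutions of `v' = -K v` decay if the quadratic form of `K` is coercive. -/
theorem tendsto_zero_of_hasDerivWithinAt_neg_mulVec (hc : 0 < c)
    (hK : ∀ w : ι → ℝ, c * (w ⬝ᵥ w) ≤ w ⬝ᵥ (K *ᵥ w))
    (hv : ∀ i, ∀ t, 0 ≤ t →
      HasDerivWithinAt (fun s => v s i) (-(K *ᵥ v t) i) (Set.Ici 0) t) (i : ι) :
    Tendsto (fun t => v t i) atTop (𝓝 0) := by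
  have hd : ∀ t, 0 ≤ t → HasDerivWithinAt (fun s => v s ⬝ᵥ v s * Real.exp (2 * c * s))
      (2 * (c * (v t ⬝ᵥ v t) - v t ⬝ᵥ (K *ᵥ v t)) * Real.exp (2 * c * t)) (Set.Ici 0) t := by
    intro t ht
    have h1 : HasDerivWithinAt (fun s => v s ⬝ᵥ v s) (-2 * (v t ⬝ᵥ (K *ᵥ v t))) (Set.Ici 0) t := by
      refine (HasDerivWithinAt.fun_sum fun j _ => (hv j t ht).mul (hv j t ht)).congr_deriv ?_
      rw [dotProduct, Finset.mul_sum]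
      exact Finset.sum_congr rfl fun j _ => by ring
    have h2 : HasDerivWithinAt (fun s => Real.exp (2 * c * s))
        (Real.exp (2 * c * t) * (2 * c)) (Set.Ici 0) t :=
      (((hasDerivAt_id t).const_mul (2 * c)).exp.congr_deriv (by simp)).hasDerivWithinAt
    exact (h1.mul h2).congr_deriv (by ring)
  have hanti : AntitoneOn (fun s => v s ⬝ᵥ v s * Real.exp (2 * c * s)) (Set.Ici 0) := by
    refine antitoneOn_of_hasDerivWithinAt_nonpos (convex_Ici 0)
      (fun t ht => (hd t ht).continuousWithinAt)
      (fun t ht => (hd t (interior_subset ht)).mono interior_subset) fun t _ => ?_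
    exact mul_nonpos_of_nonpos_of_nonneg (by linarith [hK (v t)]) (Real.exp_pos _).le
  have hbound : ∀ t, 0 ≤ t → v t i ^ 2 ≤ v 0 ⬝ᵥ v 0 * Real.exp (-(2 * c * t)) := by
    intro t ht
    have h1 := hanti (Set.mem_Ici.2 le_rfl) ht ht
    simp only [mul_zero, Real.exp_zero, mul_one] at h1
    have h2 : v t i ^ 2 ≤ v t ⬝ᵥ v t := by
      rw [sq]
      exact Finset.single_le_sum (f := fun j => v t j * v t j)
        (fun j _ => mul_self_nonneg _) (Finset.mem_univ i)
    rw [Real.exp_neg, ← div_eq_mul_inv, le_div_iff₀ (Real.exp_pos _)]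
    exact (mul_le_mul_of_nonneg_right h2 (Real.exp_pos _).le).trans h1
  have hlim : Tendsto (fun t => v 0 ⬝ᵥ v 0 * Real.exp (-(2 * c * t))) atTop (𝓝 0) := by
    have : Tendsto (fun t : ℝ => 2 * c * t) atTop atTop :=
      tendsto_id.const_mul_atTop (by positivity)
    simpa using (Real.tendsto_exp_neg_atTop_nhds_zero.comp this).const_mul (v 0 ⬝ᵥ v 0)
  have hsq : Tendsto (fun t => v t i ^ 2) atTop (𝓝 0) :=
    squeeze_zero' (Eventually.of_forall fun t => sq_nonneg _)
      ((eventually_ge_atTop 0).mono hbound) hlim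
  have := hsq.sqrt
  simp only [Real.sqrt_sq_eq_abs, Real.sqrt_zero] at this
  exact (tendsto_zero_iff_abs_tendsto_zero _).2 this

/-- A linear readout driven by a decaying linear system converges to its value at time zero corrected
by the integrated residual. -/
theorem tendsto_of_hasDerivWithinAt_neg_dotProduct [DecidableEq ι] (hc : 0 < c) (hKu : IsUnit K)
    (hK : ∀ w : ι → ℝ, c * (w ⬝ᵥ w) ≤ w ⬝ᵥ (K *ᵥ w))
    (hv : ∀ i, ∀ t, 0 ≤ t →
      HasDerivWithinAt (fun s => v s i) (-(K *ᵥ v t) i) (Set.Ici 0) t)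
    {u : ℝ → ℝ} {k : ι → ℝ}
    (hu : ∀ t, 0 ≤ t → HasDerivWithinAt u (-(k ⬝ᵥ v t)) (Set.Ici 0) t) :
    Tendsto u atTop (𝓝 (u 0 - k ⬝ᵥ (K⁻¹ *ᵥ v 0))) := by
  set l : ι → ℝ := k ᵥ* K⁻¹ with hl
  have hlk : ∀ w, l ⬝ᵥ (K *ᵥ w) = k ⬝ᵥ w := fun w => by
    rw [hl, ← Matrix.dotProduct_mulVec, Matrix.mulVec_mulVec,
      Matrix.nonsing_inv_mul _ ((Matrix.isUnit_iff_isUnit_det _).1 hKu), Matrix.one_mulVec]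
  have hd : ∀ t, 0 ≤ t → HasDerivWithinAt (fun s => u s - l ⬝ᵥ v s) 0 (Set.Ici 0) t := by
    intro t ht
    have h1 : HasDerivWithinAt (fun s => l ⬝ᵥ v s) (l ⬝ᵥ (-(K *ᵥ v t))) (Set.Ici 0) t :=
      HasDerivWithinAt.fun_sum fun j _ => (hv j t ht).const_mul (l j)
    refine ((hu t ht).sub h1).congr_deriv ?_
    rw [dotProduct_neg, hlk]; ring
  have hconst : ∀ t, 0 ≤ t → u t - l ⬝ᵥ v t = u 0 - l ⬝ᵥ v 0 := fun t ht =>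
    constant_of_has_deriv_right_zero (a := 0) (b := t)
      (fun s hs => (hd s hs.1).continuousWithinAt.mono Set.Icc_subset_Ici_self)
      (fun s hs => (hd s hs.1).mono (Set.Ici_subset_Ici.2 hs.1)) t ⟨ht, le_rfl⟩
  have hlim : Tendsto (fun t => (u 0 - l ⬝ᵥ v 0) + l ⬝ᵥ v t) atTop (𝓝 ((u 0 - l ⬝ᵥ v 0) + 0)) := by
    refine Tendsto.const_add _ ?_
    have := tendsto_finsetSum Finset.univ fun j _ =>
      (tendsto_zero_of_hasDerivWithinAt_neg_mulVec hc hK hv j).const_mul (l j)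
    simpa [dotProduct] using this
  rw [Matrix.dotProduct_mulVec, ← hl]
  rw [add_zero] at hlim
  refine hlim.congr' ((eventually_ge_atTop 0).mono fun t ht => ?_)
  rw [← hconst t ht]; ring

end LinearDynamics

section Training

theorem sphereInner_self {d : ℕ} (p : UnitSphere d) : sphereInner p p = 1 := by
  rw [sphereInner, real_inner_self_eq_norm_sq, norm_eq_of_mem_sphere, one_pow]

theorem abs_sphereInner_le_one {d : ℕ} (p q : UnitSphere d) : |sphereInner p q| ≤ 1 := by
  simpa [sphereInner, norm_eq_of_mem_sphere] using
    abs_real_inner_le_norm (p : EuclideanSpace ℝ (Fin d)) (q : EuclideanSpace ℝ (Fin d))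

/-- Beyond the convergence depth the kernel matrix is close to a multiple of the identity. -/
theorem IsNormalizedActivation.norm_ntkMatrix_sub_le {σ : ℝ → ℝ} (hσ : IsNormalizedActivation σ)
    (hμ : 0 < nonlinearityCoeff σ) (τ : Fin 2) {d n : ℕ} [NeZero n] (x : Fin n → UnitSphere d)
    {δ : ℝ} {L : ℕ} (hδ : 0 < δ) (hδ1 : δ ≤ 1)
    (hx : ∀ i j, i ≠ j → |sphereInner (x i) (x j)| ≤ 1 - δ)
    (hL : convDepth n δ (nonlinearityCoeff σ) ≤ L) :
    ‖ntkMatrix σ τ L x - ntk σ τ L 1 • (1 : Matrix (Fin n) (Fin n) ℝ)‖ ≤ ntk σ τ L 1 / 2 ∧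
    ‖ntkMatrix σ τ L x - ntk σ τ L 1 • (1 : Matrix (Fin n) (Fin n) ℝ)‖ ≤
      ntk σ τ L 1 / (n : ℝ) ^ 2 := by
  have ha := hσ.ntk_one_pos τ L
  set a := ntk σ τ L 1 with had
  set E := ntkMatrix σ τ L x - a • (1 : Matrix (Fin n) (Fin n) ℝ) with hE
  have hn1 : 1 ≤ n := NeZero.one_le
  have hn0 : (0 : ℝ) < n := by exact_mod_cast hn1
  have hdiag : ∀ i, E i i = 0 := fun i => by
    simp [hE, ntkMatrix, sphereInner_self, had]
  have hoff : ∀ i j, i ≠ j → |E i j| ≤ a * (1 / (n : ℝ) ^ 4) := fun i j hij => by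
    have h1 : E i j = ntk σ τ L (sphereInner (x i) (x j)) := by
      simp [hE, ntkMatrix, Matrix.one_apply_ne hij]
    rw [h1]
    refine (hσ.abs_ntk_le hμ τ L (abs_sphereInner_le_one _ _)).trans ?_
    exact mul_le_mul_of_nonneg_left (iterate_corrMap_le_of_convDepth_le hμ
      IsNormalizedActivation.nonlinearityCoeff_le_one hn1 hδ hδ1 hL (abs_nonneg _)
      (hx i j hij)) ha.le
  rcases hn1.eq_or_lt with h | h
  · subst h
    have : E = 0 := by
      ext i j
      rw [Subsingleton.elim j i, hdiag i, Matrix.zero_apply]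
    rw [this, norm_zero]
    constructor <;> positivity
  · have hn2 : (2 : ℝ) ≤ n := by exact_mod_cast h
    have hnorm : ‖E‖ ≤ n * (a * (1 / (n : ℝ) ^ 4)) := by
      have := Matrix.l2_opNorm_le_of_abs_le (A := E) (e := a * (1 / (n : ℝ) ^ 4)) (by positivity)
        fun i j => by
          by_cases hij : i = j
          · subst hij; rw [hdiag, abs_zero]; positivity
          · exact hoff i j hij
      simpa using this
    have h3 : (n : ℝ) * (a * (1 / (n : ℝ) ^ 4)) = a / (n : ℝ) ^ 3 := by field_simp
    rw [h3] at hnorm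
    refine ⟨hnorm.trans ?_, hnorm.trans ?_⟩
    · gcongr
      nlinarith [mul_le_mul hn2 hn2 zero_le_two hn0.le]
    · gcongr
      · linarith
      · norm_num

theorem abs_dotProduct_sub_le {n : ℕ} [NeZero n] {K : Matrix (Fin n) (Fin n) ℝ} {a : ℝ}
    (ha : 0 < a) (h2 : ‖K - a • (1 : Matrix (Fin n) (Fin n) ℝ)‖ ≤ a / 2)
    (hn : ‖K - a • (1 : Matrix (Fin n) (Fin n) ℝ)‖ ≤ a / (n : ℝ) ^ 2) {k y : Fin n → ℝ}
    (hk : ∀ i, |k i| ≤ a) (hy : ∀ i, |y i| ≤ 1) :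
    |k ⬝ᵥ (K⁻¹ *ᵥ y) - a⁻¹ * (k ⬝ᵥ y)| ≤ 2 / n := by
  have hn0 : (0 : ℝ) < n := by exact_mod_cast (NeZero.one_le : 1 ≤ n)
  have h1 : k ⬝ᵥ (K⁻¹ *ᵥ y) - a⁻¹ * (k ⬝ᵥ y) =
      -(k ⬝ᵥ (((a • (1 : Matrix (Fin n) (Fin n) ℝ))⁻¹ - K⁻¹) *ᵥ y)) := by
    rw [Matrix.inv_smul_one ha.ne', Matrix.sub_mulVec, Matrix.smul_mulVec, Matrix.one_mulVec,
      dotProduct_sub, dotProduct_smul, smul_eq_mul]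
    ring
  have hD : ‖(a • (1 : Matrix (Fin n) (Fin n) ℝ))⁻¹ - K⁻¹‖ ≤
      a⁻¹ * (a / (n : ℝ) ^ 2 * (2 * a⁻¹)) := by
    refine (Matrix.norm_inv_smul_one_sub_inv_le ha (Matrix.isUnit_of_norm_sub_le ha h2)).trans ?_
    have := Matrix.norm_inv_le_of_norm_sub_le ha h2
    gcongr
  have hk' := EuclideanSpace.norm_toLp_le ha.le hk
  have hy' := EuclideanSpace.norm_toLp_le zero_le_one hy
  rw [Fintype.card_fin] at hk' hy'
  rw [h1, abs_neg]
  refine (Matrix.abs_dotProduct_mulVec_le _ _ _).trans ?_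
  calc _ ≤ √n * a * (a⁻¹ * (a / (n : ℝ) ^ 2 * (2 * a⁻¹)) * (√n * 1)) := by gcongr
    _ = (√n * √n) * (2 / (n : ℝ) ^ 2) := by field_simp
    _ = 2 / n := by rw [Real.mul_self_sqrt hn0.le]; field_simp

theorem IsInfiniteWidthTraining.exists_limit {σ : ℝ → ℝ} {τ : Fin 2} {L d n : ℕ}
    {x : Fin n → UnitSphere d} {y : Fin n → ℝ} {Ω : Type*} [MeasurableSpace Ω] {P : Measure Ω}
    [IsProbabilityMeasure P] {f : ℝ → UnitSphere d → Ω → ℝ}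
    (hf : IsInfiniteWidthTraining σ τ L x y P f) {c : ℝ} (hc : 0 < c)
    (hKu : IsUnit (ntkMatrix σ τ L x))
    (hK : ∀ w : Fin n → ℝ, c * (w ⬝ᵥ w) ≤ w ⬝ᵥ (ntkMatrix σ τ L x *ᵥ w)) (p : UnitSphere d) :
    ∃ F : Ω → ℝ, (∀ᵐ ω ∂P, Tendsto (fun t => f t p ω) atTop (𝓝 (F ω))) ∧ Integrable F P ∧
      ∫ ω, F ω ∂P = ntkVector σ τ L x p ⬝ᵥ ((ntkMatrix σ τ L x)⁻¹ *ᵥ y) := by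
  set K := ntkMatrix σ τ L x
  set k := ntkVector σ τ L x p
  set l : Fin n → ℝ := k ᵥ* K⁻¹ with hl
  have hint : ∀ q, Integrable (f 0 q) P := fun q =>
    (hf.gaussian_init.hasGaussianLaw_eval q).integrable
  have hinti : ∀ i, Integrable (fun ω => l i * (f 0 (x i) ω - y i)) P := fun i =>
    ((hint (x i)).sub (integrable_const _)).const_mul _
  refine ⟨fun ω => f 0 p ω - ∑ i, l i * (f 0 (x i) ω - y i), ?_, ?_, ?_⟩
  · filter_upwards [hf.gradient_flow p, ae_all_iff.2 fun i => hf.gradient_flow (x i)] with ω hp hx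
    have := tendsto_of_hasDerivWithinAt_neg_dotProduct (K := K) (k := k)
      (v := fun t i => f t (x i) ω - y i) (u := fun t => f t p ω) hc hKu hK
      (fun i t ht => (hx i t ht).sub_const (y i)) (fun t ht => hp t ht)
    rwa [Matrix.dotProduct_mulVec] at this
  · exact (hint p).sub (integrable_finsetSum _ fun i _ => hinti i)
  · rw [integral_sub (hint p) (integrable_finsetSum _ fun i _ => hinti i), hf.mean_init,
      integral_finsetSum _ fun i _ => hinti i, Matrix.dotProduct_mulVec, ← hl, zero_sub,
      dotProduct, ← Finset.sum_neg_distrib]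
    refine Finset.sum_congr rfl fun i _ => ?_
    rw [integral_const_mul, integral_sub (hint _) (integrable_const _), hf.mean_init]
    simp

end Training

theorem mainTheorem2 :
    ∃ C : ℝ, ∀ (σ : ℝ → ℝ), IsNormalizedActivation σ → 0 < nonlinearityCoeff σ →
      ∀ (τ : Fin 2) (d n : ℕ) [NeZero n] (x : Fin n → UnitSphere d) (y : Fin n → ℝ) (δ : ℝ)
        (L : ℕ),
        (∀ i, y i = 1 ∨ y i = -1) →
        0 < δ → δ ≤ 1 →
        (∀ i j, i ≠ j → |sphereInner (x i) (x j)| ≤ 1 - δ) →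
        convDepth n δ (nonlinearityCoeff σ) ≤ (L : ℝ) →
        let K : Matrix (Fin n) (Fin n) ℝ := ntkMatrix σ τ L x
        let M : Matrix (Fin n) (Fin n) ℝ := K 0 0 • (1 : Matrix (Fin n) (Fin n) ℝ)
        IsUnit K ∧ IsUnit M ∧
        ‖M⁻¹ - K⁻¹‖ / ‖K⁻¹‖ ≤ C / n ∧
        ∀ (p : UnitSphere d) (Ω : Type*) [MeasurableSpace Ω] (P : Measure Ω)
          [IsProbabilityMeasure P] (f : ℝ → UnitSphere d → Ω → ℝ),
          IsInfiniteWidthTraining σ τ L x y P f →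
          ∃ F : Ω → ℝ,
            (∀ᵐ ω ∂P, Tendsto (fun t => f t p ω) atTop (𝓝 (F ω))) ∧
            Integrable F P ∧
            ∫ ω, F ω ∂P = ntkVector σ τ L x p ⬝ᵥ (K⁻¹ *ᵥ y) ∧
            |∫ ω, F ω ∂P - (K 0 0)⁻¹ * (ntkVector σ τ L x p ⬝ᵥ y)| ≤ C / n := by
  refine ⟨2, fun σ hσ hμ τ d n _ x y δ L hy hδ hδ1 hx hL => ?_⟩
  intro K M
  have ha := hσ.ntk_one_pos τ L
  obtain ⟨h2, hn⟩ := hσ.norm_ntkMatrix_sub_le hμ τ x hδ hδ1 hx hL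
  have hn1 : (1 : ℝ) ≤ n := by exact_mod_cast (NeZero.one_le : 1 ≤ n)
  have hK00 : K 0 0 = ntk σ τ L 1 := by simp [K, ntkMatrix, sphereInner_self]
  have hKu : IsUnit K := Matrix.isUnit_of_norm_sub_le ha h2
  have hM : M = ntk σ τ L 1 • (1 : Matrix (Fin n) (Fin n) ℝ) := by rw [← hK00]
  refine ⟨hKu, ?_, ?_, fun p Ω _ P _ f hf => ?_⟩
  · rw [hM]
    exact Matrix.isUnit_of_norm_sub_le ha (by simpa using (half_pos ha).le)
  · refine div_le_of_le_mul₀ (norm_nonneg _) (by positivity) ?_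
    rw [hM]
    refine (Matrix.norm_inv_smul_one_sub_inv_le ha hKu).trans ?_
    rw [← mul_assoc]
    refine mul_le_mul_of_nonneg_right ?_ (norm_nonneg _)
    calc (ntk σ τ L 1)⁻¹ * ‖K - ntk σ τ L 1 • (1 : Matrix (Fin n) (Fin n) ℝ)‖
        ≤ (ntk σ τ L 1)⁻¹ * (ntk σ τ L 1 / (n : ℝ) ^ 2) := by gcongr
      _ = 1 / (n : ℝ) ^ 2 := by field_simp
      _ ≤ 2 / n := by
        gcongr
        · norm_num
        · exact le_self_pow₀ hn1 two_ne_zero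
  · obtain ⟨F, hF, hFi, hFe⟩ := hf.exists_limit (half_pos ha) hKu
      (Matrix.le_dotProduct_mulVec_of_norm_sub_le h2) p
    refine ⟨F, hF, hFi, hFe, ?_⟩
    rw [hFe, hK00]
    refine abs_dotProduct_sub_le ha h2 hn
      (fun i => hσ.abs_ntk_le_one hμ τ L (abs_sphereInner_le_one _ _)) fun i => ?_
    rcases hy i with h | h <;> simp [h]
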